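/- Let $\Bbbk$ be a field and $R_n=\Bbbk[x_1,\dots,x_n]$ for $n\ge 1$. For $n\ge m\ge1$ let $\mathrm{Inc}_{m,n}$ be the set of strictly increasing maps $\pi$ from the positive integers to themselves with $\pi(m)\le n$; each such $\pi$ acts as the $\Bbbk$-algebra map $R_m\to R_n$, $x_i\mapsto x_{\pi(i)}$. Let $\mathcal I=(I_n)_{n\ge1}$ be a chain in which $I_n=\langle x_ix_j\mid \{i,j\}\in E(G_n)\rangle\subseteq R_n$ is the edge ideal of a simple graph $G_n$ on $\{1,\dots,n\}$. Assume that $\mathcal I$ is $\mathrm{Inc}$-invariant, i.e. $\langle \mathrm{Inc}_{m,n}(I_m)\rangle_{R_n}\subseteq I_n$ for all $n\ge m\ge1$, and that $I_n\neq0$ for all large $n$. Let $r\ge 1$ be the stability index of $\mathcal I$, i.e. the smallest positive integer such that $\langle \mathrm{Inc}_{m,n}(I_m)\rangle_{R_n}=I_n$ for all $n\ge m\ge r$ (such an integer always exists). Let $i_1$ and $p$ be the smallest and the largest index of a variable dividing some minimal monomial generator of $I_r$, and put $$\widetilde r=p-i_1+1,\qquad \mathrm{sp}(\mathcal I)=\min\{\,j-i\mid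 i<j,\ \{i,j\}\in E(G_r)\,\}.$$ Then, for all $n\ge r+2\widetilde r$, $$\operatorname{depth}(R_n/I_n)\le r-\widetilde r+\mathrm{sp}(\mathcal I),$$ where depth is taken with respect to the graded maximal ideal $\langle x_1,\dots,x_n\rangle$. -/

import Mathlib

open MvPolynomial

namespace InvChain

/-! The variables `x₁, …, xₙ` of the polynomial ring `R_n = K[x₁, …, xₙ]` are `X i` with
`i : Fin n`; the variable `x_{i+1}` of the text is `X i`. Likewise the positive integer `i + 1`
is represented by the natural number `i` in the definition of `Inc`. -/

section Depth

variable {R : Type*} [CommRing R]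

/-- The depth of `M` with respect to the ideal `J`: the supremum of the lengths of the
`M`-regular sequences whose members all lie in `J`. -/
noncomputable def depth (J : Ideal R) (M : Type*) [AddCommGroup M] [Module R M] : ℕ∞ :=
  sSup {d : ℕ∞ | ∃ s : List R,
    (∀ f ∈ s, f ∈ J) ∧ RingTheory.Sequence.IsRegular M s ∧ d = (s.length : ℕ∞)}

end Depth

section Ideals

variable (K : Type*) [Field K]

/-- The graded maximal ideal `⟨x₁, …, xₙ⟩` of `R_n`. -/
noncomputable def gradedMaximalIdeal (n : ℕ) : Ideal (MvPolynomial (Fin n) K) :=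
  Ideal.span (Set.range (X : Fin n → MvPolynomial (Fin n) K))

/-- The edge ideal `⟨x_i x_j | {i, j} ∈ E(G)⟩` of a simple graph on `n` vertices. -/
noncomputable def edgeIdeal {n : ℕ} (G : SimpleGraph (Fin n)) :
    Ideal (MvPolynomial (Fin n) K) :=
  Ideal.span {f | ∃ i j : Fin n, G.Adj i j ∧ f = X i * X j}

/-- The monoid of strictly increasing maps. -/
def Inc : Set (ℕ → ℕ) := {π | StrictMono π}

/-- The strictly increasing maps sending the first `m` positive integers into the first `n`
(equivalently, for `m ≥ 1`, whose value at the `m`-th positive integer is among the first `n`). -/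
def IncTo (m n : ℕ) : Set (ℕ → ℕ) := {π | π ∈ Inc ∧ ∀ i < m, π i < n}

variable {K}

/-- The ring map `R_m → R_n`, `x_i ↦ x_{π(i)}`, given by `π ∈ Inc_{m,n}`. -/
noncomputable def act {m n : ℕ} (π : IncTo m n) :
    MvPolynomial (Fin m) K →ₐ[K] MvPolynomial (Fin n) K :=
  rename (fun i : Fin m => (⟨π.1 i, π.2.2 i i.2⟩ : Fin n))

/-- The ideal `⟨Inc_{m,n}(J)⟩` of `R_n` generated by all `π(f)`, `π ∈ Inc_{m,n}`, `f ∈ J`. -/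
noncomputable def incSpan {m : ℕ} (n : ℕ) (J : Ideal (MvPolynomial (Fin m) K)) :
    Ideal (MvPolynomial (Fin n) K) :=
  Ideal.span {g | ∃ π : IncTo m n, ∃ f ∈ J, g = act π f}

/-- The chain `(I_n)_{n ≥ 1}` is `Inc`-invariant. (`I 0` plays no role.) -/
def IsIncInvariant (I : ∀ n : ℕ, Ideal (MvPolynomial (Fin n) K)) : Prop :=
  ∀ m n : ℕ, 1 ≤ m → m ≤ n → incSpan n (I m) ≤ I n

/-- The stability index: the smallest `r ≥ 1` such that `⟨Inc_{m,n}(I_m)⟩ = I_n` for all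
`n ≥ m ≥ r`. -/
noncomputable def stabilityIndex (I : ∀ n : ℕ, Ideal (MvPolynomial (Fin n) K)) : ℕ :=
  sInf {r : ℕ | 1 ≤ r ∧ ∀ m n : ℕ, r ≤ m → m ≤ n → incSpan n (I m) = I n}

/-- The exponent vectors of the minimal monomial generators of a monomial ideal `J`: the
monomials in `J` that are minimal with respect to divisibility. -/
def minimalGenerators {n : ℕ} (J : Ideal (MvPolynomial (Fin n) K)) : Set (Fin n →₀ ℕ) :=
  {a | Minimal (fun b : Fin n →₀ ℕ => monomial b (1 : K) ∈ J) a}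

/-- The indices (counted from `1`) of the variables dividing some minimal monomial generator. -/
def generatorSupport {n : ℕ} (J : Ideal (MvPolynomial (Fin n) K)) : Set ℕ :=
  {k | ∃ i : Fin n, (∃ a ∈ minimalGenerators J, a i ≠ 0) ∧ k = (i : ℕ) + 1}

/-- The smallest index of a variable dividing some minimal monomial generator. -/
noncomputable def minSupp {n : ℕ} (J : Ideal (MvPolynomial (Fin n) K)) : ℕ :=
  sInf (generatorSupport J)

/-- The largest index of a variable dividing some minimal monomial generator. -/
noncomputable def maxSupp {n : ℕ} (J : Ideal (MvPolynomial (Fin n) K)) : ℕ :=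
  sSup (generatorSupport J)

/-- The number `r̃ = maxSupp − minSupp + 1`. -/
noncomputable def rTilde {n : ℕ} (J : Ideal (MvPolynomial (Fin n) K)) : ℕ :=
  maxSupp J - minSupp J + 1

/-- One has `r̃ ≤ n` for ideals of `R_n` with `n ≥ 1`, so that `n - r̃` is a true subtraction. -/
theorem rTilde_le {n : ℕ} (hn : 1 ≤ n) (J : Ideal (MvPolynomial (Fin n) K)) :
    rTilde J ≤ n := by
  unfold rTilde maxSupp minSupp
  rcases (generatorSupport J).eq_empty_or_nonempty with h | h
  · simp [h, hn]
  · have h1 : sSup (generatorSupport J) ≤ n := by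
      refine csSup_le h ?_
      rintro k ⟨i, -, rfl⟩
      exact i.2
    have h2 : 1 ≤ sInf (generatorSupport J) := by
      obtain ⟨i, -, hi⟩ := Nat.sInf_mem h
      omega
    omega

end Ideals

/-- The sparsity index of a graph: the least `j - i` over all edges `{i, j}` with `i < j`. -/
noncomputable def sparsityIndex {n : ℕ} (G : SimpleGraph (Fin n)) : ℕ :=
  sInf {d : ℕ | ∃ i j : Fin n, i < j ∧ G.Adj i j ∧ d = (j : ℕ) - (i : ℕ)}

end InvChain

/-! The depth of a finite module over a Noetherian ring is at most dim R/P for each associated prime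
P inside m: factoring out a regular element replaces P by a strictly larger associated prime of the
quotient (`exists_associated_prime_gt`). For an edge ideal, a maximal independent set S yields the
associated prime generated by the variables outside S, of dimension |S| (`depth_edgeIdeal_le`). It
therefore suffices to find in G_n a maximal independent set of size at most r - r̃ + sp.

By stability, a < b is an edge of G_n exactly when some edge i < j of G_r has i ≤ a, j - i ≤ b - a
and r - j ≤ n - b (`X_mul_X_mem_incSpan_iff`). Hence r - r̃ vertices at the two ends are isolated,
and any window of sp consecutive vertices is independent. For n ≥ r + 2r̃ the window can be placed
so that every other non-isolated vertex is joined to its first or last vertex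
(`exists_maximal_independent`). -/

namespace InvChain

/-! ### Depth and associated primes -/

section Depth

variable {R : Type*} [CommRing R] {M : Type*} [AddCommGroup M] [Module R M]

/-- If `x ∈ m` is regular on the finite module `M`, every associated prime `P ≤ m` of `M` is
strictly contained in an associated prime `Q ≤ m` of `M ⧸ x M`. -/
theorem exists_associated_prime_gt [IsNoetherianRing R] [Module.Finite R M] {m : Ideal R}
    [hm : m.IsPrime] {x : R} (hx : x ∈ m) (hreg : IsSMulRegular M x) {P : Ideal R}
    (hPm : P ≤ m) {z₀ : M} (hz₀ : ∀ r, r ∈ P ↔ r • z₀ = 0) :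
    ∃ Q : Ideal R, Q.IsPrime ∧ P < Q ∧ Q ≤ m ∧
      ∃ z : QuotSMulTop x M, ∀ r, r ∈ Q ↔ r • z = 0 := by
  have hz₀m : ∀ r, r • z₀ = 0 → r ∈ m := fun r hr => hPm ((hz₀ r).2 hr)
  let N : Submodule R M := Submodule.torsionBySet R M (P : Set R)
  have hN : ∀ z, z ∈ N ↔ ∀ p ∈ P, p • z = 0 := fun z => by
    simp [N, Submodule.mem_torsionBySet_iff]
  let N' : Submodule R (QuotSMulTop x M) := N.map (Submodule.mkQ _)
  -- If m is not in the support, some a ∉ m kills the image of N in M/xM; a determinant trick on N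
  -- rules this out.
  have key : (⟨m, hm⟩ : PrimeSpectrum R) ∈ Module.support R N' := by
    rw [Module.support_eq_zeroLocus, PrimeSpectrum.mem_zeroLocus]
    intro a ha
    by_contra ham
    change a ∉ m at ham
    -- aN lies in xM, and even in xN: cancelling the regular element x shows that the quotient y is
    -- again killed by P.
    have h1 : ∀ z ∈ N, ∃ y ∈ N, a • z = x • y := by
      intro z hz
      have h2 : a • (Submodule.mkQ _ z : QuotSMulTop x M) = 0 := by
        have h3 := Module.mem_annihilator.1 ha ⟨_, Submodule.mem_map_of_mem hz⟩
        exact congrArg Subtype.val h3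
      rw [← map_smul, Submodule.mkQ_apply, Submodule.Quotient.mk_eq_zero] at h2
      obtain ⟨y, -, hy⟩ := (Submodule.mem_smul_pointwise_iff_exists _ _ _).1 h2
      refine ⟨y, (hN y).2 fun p hp => hreg ?_, hy.symm⟩
      change x • p • y = x • 0
      rw [smul_comm, hy, smul_comm, (hN z).1 hz p hp, smul_zero, smul_zero]
    let f : Module.End R N := a • LinearMap.id
    have hf : LinearMap.range f ≤ Ideal.span {x} • ⊤ := by
      rintro _ ⟨⟨z, hz⟩, rfl⟩
      obtain ⟨y, hy, e⟩ := h1 z hz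
      have : f ⟨z, hz⟩ = x • (⟨y, hy⟩ : N) := Subtype.ext e
      rw [this]
      exact Submodule.smul_mem_smul (Ideal.mem_span_singleton_self x) trivial
    obtain ⟨p, hp, -, hcoeff, hp0⟩ :=
      LinearMap.exists_monic_and_natDegree_eq_and_coeff_mem_pow_and_aeval_eq_zero R f _ hf
    have hz₀N : z₀ ∈ N := (hN z₀).2 fun p hp => (hz₀ p).1 hp
    have hf' : f = algebraMap R (Module.End R N) a := by
      ext; simp [f]
    rw [hf', Polynomial.aeval_algebraMap_apply] at hp0
    have h4 : (Polynomial.aeval a p) • z₀ = 0 := by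
      have := congrArg Subtype.val (LinearMap.congr_fun hp0 ⟨z₀, hz₀N⟩)
      simpa using this
    -- p(a) kills z₀, so it lies in m; all non-leading coefficients of p lie in (x) ⊆ m, which
    -- leaves a power of a in m.
    have h5 := hz₀m _ h4
    rw [hp.as_sum, map_add, map_sum, map_pow, Polynomial.aeval_X] at h5
    have h6 : ∑ i ∈ Finset.range p.natDegree,
        Polynomial.aeval a (Polynomial.C (p.coeff i) * Polynomial.X ^ i) ∈ m := by
      refine Ideal.sum_mem _ fun i hi => ?_
      rw [map_mul, Polynomial.aeval_C]
      refine Ideal.mul_mem_right _ _ ?_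
      have h7 := Ideal.pow_le_self (Nat.sub_ne_zero_of_lt (Finset.mem_range.1 hi)) (hcoeff i)
      exact (Ideal.span_singleton_le_iff_mem m).2 hx h7
    exact ham (hm.mem_of_pow_mem _ ((Ideal.add_mem_iff_left _ h6).1 h5))
  obtain ⟨⟨z, hzN⟩, hz⟩ := Module.mem_support_iff_exists_annihilator.1 key
  have hz' : ∀ r : R, r • z = 0 → r ∈ m := fun r hr =>
    hz ((Submodule.mem_annihilator_span_singleton _ _).2 (Subtype.ext hr))
  have hcol : ∀ (w : QuotSMulTop x M) (r : R),
      r ∈ (⊥ : Submodule R (QuotSMulTop x M)).colon {w} ↔ r • w = 0 := fun w r => by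
    simp [Submodule.mem_colon_singleton]
  obtain ⟨Q, hQ, hQm⟩ := Ideal.exists_minimalPrimes_le
    (I := (⊥ : Submodule R (QuotSMulTop x M)).colon {z}) (J := m)
    fun r hr => hz' r ((hcol z r).1 hr)
  have hzQ : ∀ r : R, r • z = 0 → r ∈ Q := fun r hr => hQ.1.2 ((hcol z r).2 hr)
  obtain ⟨w, hw⟩ := Submodule.exists_eq_colon_of_mem_minimalPrimes hQ
  have hPz : ∀ r ∈ P, r • z = 0 := by
    intro r hr
    obtain ⟨y, hy, rfl⟩ := hzN
    rw [← map_smul, (hN y).1 hy r hr, map_zero]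
  have hxz : x • z = 0 := by
    obtain ⟨y, -, rfl⟩ := hzN
    rw [← map_smul, Submodule.mkQ_apply, Submodule.Quotient.mk_eq_zero]
    exact Submodule.smul_mem_pointwise_smul _ _ _ trivial
  -- Strictness comes from x: it kills z, so it lies in Q, but being regular it cannot kill z₀ ≠ 0.
  refine ⟨Q, hQ.1.1, lt_of_le_of_ne (fun r hr => hzQ r (hPz r hr)) ?_, hQm, w, fun r => ?_⟩
  · rintro rfl
    have h8 : x • z₀ = x • 0 := by rw [(hz₀ x).1 (hzQ x hxz), smul_zero]
    have h9 : z₀ = 0 := hreg h8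
    exact hm.ne_top ((Ideal.eq_top_iff_one _).2 (hz₀m 1 (by simp [h9])))
  · rw [← hcol, ← hw]

/-- The length of a weakly regular sequence in `m` is at most the coheight of every associated
prime contained in `m`. -/
theorem length_le_coheight_of_isWeaklyRegular {R : Type*} [CommRing R] [IsNoetherianRing R]
    {m : Ideal R} [m.IsPrime] (s : List R) (hs : ∀ f ∈ s, f ∈ m) :
    ∀ {M : Type*} [AddCommGroup M] [Module R M] [Module.Finite R M],
      RingTheory.Sequence.IsWeaklyRegular M s →
      ∀ (P : PrimeSpectrum R), P.asIdeal ≤ m →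
      ∀ z₀ : M, (∀ r, r ∈ P.asIdeal ↔ r • z₀ = 0) →
      (s.length : ℕ∞) ≤ Order.coheight P := by
  induction s with
  | nil => intros; simp
  | cons x s ih =>
    intro M _ _ _ hreg P hPm z₀ hz₀
    rw [RingTheory.Sequence.isWeaklyRegular_cons_iff] at hreg
    obtain ⟨Q, hQ, hPQ, hQm, z, hz⟩ :=
      exists_associated_prime_gt (hs x (by simp)) hreg.1 hPm hz₀
    have h := ih (fun f hf => hs f (by simp [hf])) hreg.2 ⟨Q, hQ⟩ hQm z hz
    have hlt : P < ⟨Q, hQ⟩ := hPQ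
    rw [List.length_cons, Nat.cast_add, Nat.cast_one]
    exact (add_le_add_left h 1).trans (Order.coheight_add_one_le hlt)

theorem coheight_le_ringKrullDim_quotient {R : Type*} [CommRing R] (P : PrimeSpectrum R) :
    (Order.coheight P : WithBot ℕ∞) ≤ ringKrullDim (R ⧸ P.asIdeal) := by
  rw [ringKrullDim_quotient, Order.coheight_eq_krullDim_Ici]
  refine le_of_eq (congrArg (fun s : Set (PrimeSpectrum R) => Order.krullDim s) ?_)
  ext Q
  rfl

/-- The depth of a finite module is at most the dimension of `R ⧸ P` for each associated
prime `P`. -/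
theorem depth_le_ringKrullDim_quotient [IsNoetherianRing R] [Module.Finite R M] {m : Ideal R}
    [m.IsPrime] {P : Ideal R} [hP : P.IsPrime] (hPm : P ≤ m) {z₀ : M}
    (hz₀ : ∀ r, r ∈ P ↔ r • z₀ = 0) :
    (depth m M : WithBot ℕ∞) ≤ ringKrullDim (R ⧸ P) := by
  refine le_trans ?_ (coheight_le_ringKrullDim_quotient ⟨P, hP⟩)
  rw [WithBot.coe_le_coe]
  refine sSup_le ?_
  rintro d ⟨s, hs, hreg, rfl⟩
  exact length_le_coheight_of_isWeaklyRegular s hs hreg.toIsWeaklyRegular ⟨P, hP⟩ hPm z₀ hz₀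

end Depth

/-! ### Associated primes of edge ideals from maximal independent sets -/

section EdgeIdeal

variable (K : Type*) [Field K]

/-- The ideal generated by the variables outside `S` is the kernel of the map setting these
variables to zero. -/
theorem span_X_compl_eq_ker {σ : Type*} (S : Set σ) :
    Ideal.span (X '' Sᶜ) =
      RingHom.ker (killCompl (R := K) (Subtype.val_injective : (Subtype.val : S → σ).Injective)) := by
  set φ := killCompl (R := K) (Subtype.val_injective : (Subtype.val : S → σ).Injective) with hφ
  apply le_antisymm
  · rw [Ideal.span_le]
    rintro _ ⟨v, hv, rfl⟩
    have : v ∉ Set.range (Subtype.val : S → σ) := by simpa using hv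
    rw [SetLike.mem_coe, RingHom.mem_ker, hφ, killCompl, aeval_X, dif_neg this]
  · intro g hg
    set J : Ideal (MvPolynomial σ K) := Ideal.span (X '' Sᶜ)
    have h : ((Ideal.Quotient.mkₐ K J).comp (rename (Subtype.val : S → σ))).comp φ =
        Ideal.Quotient.mkₐ K J := by
      ext v
      by_cases hv : v ∈ S
      · have h1 : φ (X v) = X ⟨v, hv⟩ := by
          have := killCompl_rename_app (R := K)
            (Subtype.val_injective : (Subtype.val : S → σ).Injective) (X ⟨v, hv⟩)
          rwa [rename_X] at this
        simp [h1]
      · have h1 : v ∉ Set.range (Subtype.val : S → σ) := by simpa using hv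
        have h2 : φ (X v) = 0 := by rw [hφ, killCompl, aeval_X, dif_neg h1]
        have h3 : (X v : MvPolynomial σ K) ∈ J := Ideal.subset_span ⟨v, hv, rfl⟩
        simpa [h2] using (Ideal.Quotient.eq_zero_iff_mem.2 h3).symm
    have h4 := AlgHom.congr_fun h g
    rw [RingHom.mem_ker] at hg
    simp only [AlgHom.comp_apply] at h4
    rw [show φ g = 0 from hg, map_zero, map_zero] at h4
    exact Ideal.Quotient.eq_zero_iff_mem.1 h4.symm

instance span_X_compl_isPrime {σ : Type*} (S : Set σ) :
    (Ideal.span (X '' Sᶜ : Set (MvPolynomial σ K))).IsPrime := by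
  rw [span_X_compl_eq_ker]
  exact RingHom.ker_isPrime _

instance gradedMaximalIdeal_isPrime (n : ℕ) : (gradedMaximalIdeal K n).IsPrime := by
  have h := span_X_compl_isPrime K (∅ : Set (Fin n))
  rwa [Set.compl_empty, Set.image_univ] at h

theorem ringKrullDim_quotient_span_X_compl {σ : Type*} (S : Set σ) [Finite S] :
    ringKrullDim (MvPolynomial σ K ⧸ (Ideal.span (X '' Sᶜ : Set (MvPolynomial σ K)))) =
      (S.ncard : WithBot ℕ∞) := by
  have hsurj : Function.Surjective
      (killCompl (R := K) (Subtype.val_injective : (Subtype.val : S → σ).Injective)) :=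
    fun g => ⟨_, killCompl_rename_app _ g⟩
  rw [span_X_compl_eq_ker, ringKrullDim_eq_of_ringEquiv
    (Ideal.quotientKerAlgEquivOfSurjective hsurj).toRingEquiv, MvPolynomial.ringKrullDim_of_isNoetherianRing,
    ringKrullDim_eq_zero_of_field, zero_add]
  rfl

theorem edgeIdeal_le_iff {n : ℕ} (G : SimpleGraph (Fin n))
    (J : Ideal (MvPolynomial (Fin n) K)) :
    edgeIdeal K G ≤ J ↔ ∀ i j, G.Adj i j → X i * X j ∈ J := by
  rw [edgeIdeal, Ideal.span_le]
  constructor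
  · intro h i j hij
    exact h ⟨i, j, hij, rfl⟩
  · rintro h _ ⟨i, j, hij, rfl⟩
    exact h i j hij

theorem X_mem_span_X_compl_iff {σ : Type*} (S : Set σ) (v : σ) :
    (X v : MvPolynomial σ K) ∈ Ideal.span (X '' Sᶜ : Set (MvPolynomial σ K)) ↔ v ∉ S := by
  refine ⟨fun hv hvS => ?_, fun hv => Ideal.subset_span ⟨v, hv, rfl⟩⟩
  obtain ⟨i, hi, hne⟩ := mem_ideal_span_X_image.1 hv (Finsupp.single v 1)
    (by classical simp [mem_support_iff, coeff_X])
  rw [Finsupp.single_apply_ne_zero] at hne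
  exact hi (hne.1 ▸ hvS)

theorem X_mul_X_mem_span_X_compl_iff {σ : Type*} (S : Set σ) (u v : σ) :
    (X u * X v : MvPolynomial σ K) ∈ Ideal.span (X '' Sᶜ : Set (MvPolynomial σ K)) ↔
      u ∉ S ∨ v ∉ S := by
  rw [(span_X_compl_isPrime K S).mul_mem_iff_mem_or_mem, X_mem_span_X_compl_iff,
    X_mem_span_X_compl_iff]

theorem edgeIdeal_le_span_X_compl {n : ℕ} (G : SimpleGraph (Fin n)) (S : Set (Fin n))
    (hind : ∀ u ∈ S, ∀ v ∈ S, ¬ G.Adj u v) :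
    edgeIdeal K G ≤ Ideal.span (X '' Sᶜ) := by
  rw [edgeIdeal_le_iff]
  intro i j hij
  rw [X_mul_X_mem_span_X_compl_iff]
  by_contra! h
  exact hind i h.1 j h.2 hij

/-- For a non-edge, {a, b} is independent, so the prime generated by the other variables contains
the edge ideal but not the product. -/
theorem X_mul_X_mem_edgeIdeal_iff {n : ℕ} (G : SimpleGraph (Fin n)) (a b : Fin n) :
    (X a * X b : MvPolynomial (Fin n) K) ∈ edgeIdeal K G ↔ G.Adj a b := by
  refine ⟨fun h => ?_, (edgeIdeal_le_iff K G _).1 le_rfl a b⟩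
  by_contra hab
  have h1 := edgeIdeal_le_span_X_compl K G {a, b} (by
    rintro u (rfl | rfl) v (rfl | rfl) huv
    · exact huv.ne rfl
    · exact hab huv
    · exact hab huv.symm
    · exact huv.ne rfl) h
  rw [X_mul_X_mem_span_X_compl_iff] at h1
  simp at h1

/-- The depth of the quotient by an edge ideal is at most the size of each maximal independent
set. -/
theorem depth_edgeIdeal_le {n : ℕ} (G : SimpleGraph (Fin n)) (S : Finset (Fin n))
    (hind : ∀ u ∈ S, ∀ v ∈ S, ¬ G.Adj u v) (hmax : ∀ v, v ∉ S → ∃ u ∈ S, G.Adj v u) :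
    depth (gradedMaximalIdeal K n) (MvPolynomial (Fin n) K ⧸ edgeIdeal K G) ≤ (S.card : ℕ∞) := by
  set P : Ideal (MvPolynomial (Fin n) K) := Ideal.span (X '' (S : Set (Fin n))ᶜ) with hP
  have hIP : edgeIdeal K G ≤ P := edgeIdeal_le_span_X_compl K G S hind
  have hPm : P ≤ gradedMaximalIdeal K n := Ideal.span_mono (Set.image_subset_range _ _)
  have hprime : P.IsPrime := span_X_compl_isPrime K _
  have hfP : ∏ u ∈ S, (X u : MvPolynomial (Fin n) K) ∉ P := by
    rw [hprime.prod_mem_iff]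
    rintro ⟨u, hu, h⟩
    exact (X_mem_span_X_compl_iff K _ u).1 h hu
  -- P is the annihilator of the class of ∏ x_u over S: maximality makes each outside variable kill
  -- it, and conversely P is a prime containing the edge ideal but not the product.
  have hz : ∀ g, g ∈ P ↔
      g • Ideal.Quotient.mk (edgeIdeal K G) (∏ u ∈ S, X u) = 0 := by
    intro g
    rw [← Ideal.Quotient.mk_eq_mk, ← Submodule.Quotient.mk_smul, smul_eq_mul,
      Submodule.Quotient.mk_eq_zero]
    constructor
    · intro hg
      have : P ≤ (edgeIdeal K G).colon {∏ u ∈ S, (X u : MvPolynomial (Fin n) K)} := by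
        rw [hP, Ideal.span_le]
        rintro _ ⟨v, hv, rfl⟩
        obtain ⟨u, hu, hadj⟩ := hmax v hv
        rw [SetLike.mem_coe, Submodule.mem_colon_singleton, smul_eq_mul,
          ← Finset.mul_prod_erase _ _ hu, ← mul_assoc]
        exact Ideal.mul_mem_right _ _ ((X_mul_X_mem_edgeIdeal_iff K G _ _).2 hadj)
      exact Submodule.mem_colon_singleton.1 (this hg)
    · intro hg
      exact (hprime.mem_or_mem (hIP hg)).resolve_right hfP
  have h := depth_le_ringKrullDim_quotient hPm hz
  rw [hP, ringKrullDim_quotient_span_X_compl, Set.ncard_coe_finset] at h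
  exact_mod_cast h

end EdgeIdeal

/-! ### Minimal generators of edge ideals -/

section Generators

variable (K : Type*) [Field K]

theorem monomial_mem_edgeIdeal_iff {n : ℕ} (G : SimpleGraph (Fin n)) (b : Fin n →₀ ℕ) :
    monomial b (1 : K) ∈ edgeIdeal K G ↔
      ∃ i j, G.Adj i j ∧ Finsupp.single i 1 + Finsupp.single j 1 ≤ b := by
  have h : edgeIdeal K G = Ideal.span ((fun s => monomial s (1 : K)) ''
      {a | ∃ i j, G.Adj i j ∧ a = Finsupp.single i 1 + Finsupp.single j 1}) := by
    rw [edgeIdeal]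
    congr 1
    ext f
    constructor
    · rintro ⟨i, j, hij, rfl⟩
      exact ⟨_, ⟨i, j, hij, rfl⟩, by simp [X, monomial_mul]⟩
    · rintro ⟨_, ⟨i, j, hij, rfl⟩, rfl⟩
      exact ⟨i, j, hij, by simp [X, monomial_mul]⟩
  rw [h, mem_ideal_span_monomial_image]
  classical
  simp only [support_monomial, one_ne_zero, if_false, Finset.mem_singleton, forall_eq,
    Set.mem_ofPred_eq]
  constructor
  · rintro ⟨_, ⟨i, j, hij, rfl⟩, hb⟩
    exact ⟨i, j, hij, hb⟩
  · rintro ⟨i, j, hij, hb⟩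
    exact ⟨_, ⟨i, j, hij, rfl⟩, hb⟩

/-- The variables dividing a minimal generator of an edge ideal are the endpoints of edges. -/
theorem mem_generatorSupport_edgeIdeal_iff {n : ℕ} (G : SimpleGraph (Fin n)) (k : ℕ) :
    k ∈ generatorSupport (edgeIdeal K G) ↔ ∃ i j : Fin n, G.Adj i j ∧ k = (i : ℕ) + 1 := by
  constructor
  · rintro ⟨l, ⟨a, ha, hal⟩, rfl⟩
    replace ha : Minimal (fun b => monomial b (1 : K) ∈ edgeIdeal K G) a := ha
    obtain ⟨i, j, hij, hle⟩ := (monomial_mem_edgeIdeal_iff K G a).1 ha.prop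
    have hle' := ha.le_of_le ((monomial_mem_edgeIdeal_iff K G _).2 ⟨i, j, hij, le_rfl⟩) hle
    obtain rfl := le_antisymm hle hle'
    by_cases hi : i = l
    · exact ⟨i, j, hij, by rw [hi]⟩
    by_cases hj : j = l
    · exact ⟨j, i, hij.symm, by rw [hj]⟩
    simp [hi, hj] at hal
  · rintro ⟨i, j, hij, rfl⟩
    refine ⟨i, ⟨Finsupp.single i 1 + Finsupp.single j 1,
      ⟨(monomial_mem_edgeIdeal_iff K G _).2 ⟨i, j, hij, le_rfl⟩, fun b hb hble => ?_⟩, by simp⟩, rfl⟩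
    obtain ⟨i', j', -, hle⟩ := (monomial_mem_edgeIdeal_iff K G b).1 hb
    obtain ⟨w, hw⟩ := le_iff_exists_add.1 (hle.trans hble)
    -- Both monomials have degree 2, so divisibility forces equality.
    have hdeg := congrArg Finsupp.degree hw
    simp only [map_add, Finsupp.degree_single] at hdeg
    have hw0 : w = 0 := (Finsupp.degree_eq_zero_iff w).1 (by omega)
    rw [hw, hw0, add_zero]
    exact hle

end Generators

/-! ### Edges produced by increasing maps -/

section IncSpan

theorem strictMono_add_sub_le {π : ℕ → ℕ} (hπ : StrictMono π) {i j : ℕ} (hij : i ≤ j) :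
    π i + (j - i) ≤ π j := by
  obtain ⟨d, rfl⟩ := Nat.exists_eq_add_of_le hij
  rw [Nat.add_sub_cancel_left]
  clear hij
  induction d with
  | zero => rfl
  | succ d ih =>
    have := hπ (show i + d < i + (d + 1) by omega)
    omega

/-- A strictly increasing map moving the pair `i < j` to `a < b`. -/
theorem exists_incTo {m n i j a b : ℕ} (hij : i < j) (hj : j < m)
    (h1 : i ≤ a) (h2 : a + j ≤ b + i) (h3 : b + m ≤ n + j) :
    ∃ π ∈ IncTo m n, π i = a ∧ π j = b := by
  -- Identity before i, then a translation taking i to a, then one taking j to b; `h3` keeps the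
  -- image of m - 1 below n.
  refine ⟨fun t => if t < i then t else if t < j then t - i + a else t - j + b, ⟨?_, ?_⟩, ?_, ?_⟩
  · intro s t hst
    dsimp only
    split_ifs <;> omega
  · intro t ht
    dsimp only
    split_ifs <;> omega
  · simp [hij]
  · simp [hij.not_gt]

variable (K : Type*) [Field K]

/-- The edges of the graph of `⟨Inc_{m,n}(I(G))⟩`. -/
theorem X_mul_X_mem_incSpan_iff {m n : ℕ} (G : SimpleGraph (Fin m)) {a b : Fin n} (hab : a < b) :
    (X a * X b : MvPolynomial (Fin n) K) ∈ incSpan n (edgeIdeal K G) ↔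
      ∃ i j : Fin m, i < j ∧ G.Adj i j ∧ (i : ℕ) ≤ a ∧ (a : ℕ) + j ≤ b + i ∧
        (b : ℕ) + m ≤ n + j := by
  constructor
  · intro h
    by_contra hcon
    -- This prime omits X a * X b, so it suffices that it contains the image of every edge.
    have hle : incSpan n (edgeIdeal K G) ≤ Ideal.span (X '' ({a, b} : Set (Fin n))ᶜ) := by
      rw [incSpan, Ideal.span_le]
      rintro _ ⟨π, f, hf, rfl⟩
      have hcomap : edgeIdeal K G ≤
          (Ideal.span (X '' ({a, b} : Set (Fin n))ᶜ)).comap (act (K := K) π) := by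
        rw [edgeIdeal_le_iff]
        have key : ∀ i j : Fin m, G.Adj i j → i < j →
            act π (X i * X j : MvPolynomial (Fin m) K) ∈
              Ideal.span (X '' ({a, b} : Set (Fin n))ᶜ) := by
          intro i j hij hlt
          rw [map_mul, act, rename_X, rename_X, X_mul_X_mem_span_X_compl_iff]
          by_contra! hmem
          have hπ : π.1 i < π.1 j := π.2.1 hlt
          have hlt' : (i : ℕ) < j := hlt
          have hab' : (a : ℕ) < b := hab
          simp only [Set.mem_insert_iff, Set.mem_singleton_iff, Fin.ext_iff] at hmem
          have hia : π.1 i = a := by omega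
          have hjb : π.1 j = b := by omega
          refine hcon ⟨i, j, hlt, hij, ?_, ?_, ?_⟩
          · rw [← hia]
            exact π.2.1.le_apply
          · have := strictMono_add_sub_le π.2.1 hlt'.le
            omega
          · have h1 := strictMono_add_sub_le π.2.1 (show (j : ℕ) ≤ m - 1 by omega)
            have h2 := π.2.2 (m - 1) (by omega)
            omega
        intro i j hij
        rw [Ideal.mem_comap]
        rcases lt_or_gt_of_ne hij.ne with hlt | hlt
        · exact key i j hij hlt
        · rw [mul_comm]
          exact key j i hij.symm hlt
      exact hcomap hf
    have h1 := hle h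
    rw [X_mul_X_mem_span_X_compl_iff] at h1
    simp at h1
  · rintro ⟨i, j, hij, hadj, h1, h2, h3⟩
    obtain ⟨π, hπ, hi, hj⟩ := exists_incTo hij j.2 h1 h2 h3
    refine Ideal.subset_span ⟨⟨π, hπ⟩, X i * X j, (X_mul_X_mem_edgeIdeal_iff K G i j).2 hadj, ?_⟩
    rw [map_mul, act, rename_X, rename_X]
    congr 2 <;> exact Fin.ext (by simp [hi, hj])

end IncSpan

/-! ### Stabilization of the chain -/

section Stability

variable {K : Type*} [Field K] {I : ∀ n : ℕ, Ideal (MvPolynomial (Fin n) K)}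
  {G : ∀ n : ℕ, SimpleGraph (Fin n)}

/-- An `Inc`-invariant chain of edge ideals stabilizes. -/
theorem stability_nonempty (hG : ∀ n : ℕ, 1 ≤ n → I n = edgeIdeal K (G n))
    (hinv : IsIncInvariant I) :
    {r : ℕ | 1 ≤ r ∧ ∀ m n : ℕ, r ≤ m → m ≤ n → incSpan n (I m) = I n}.Nonempty := by
  -- Edges are encoded by left margin, length and right margin, with sum n. By Dickson's lemma only
  -- finitely many triples are minimal, so their sums are bounded.
  let W : Set (ℕ × ℕ × ℕ) := {t | ∃ n, ∃ a b : Fin n, a < b ∧ (G n).Adj a b ∧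
    t = ((a : ℕ), (b : ℕ) - a, n - b)}
  have hfin : {t | Minimal (· ∈ W) t}.Finite :=
    WellQuasiOrderedLE.finite_of_isAntichain (setOfPred_minimal_antichain _)
  obtain ⟨N, hN⟩ := (hfin.image fun t => t.1 + t.2.1 + t.2.2).bddAbove
  refine ⟨N + 1, by omega, fun m n hm hmn => le_antisymm (hinv m n (by omega) hmn) ?_⟩
  rw [hG n (by omega), edgeIdeal_le_iff]
  have key : ∀ a b : Fin n, (G n).Adj a b → a < b →
      (X a * X b : MvPolynomial (Fin n) K) ∈ incSpan n (I m) := by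
    intro a b hadj hab
    obtain ⟨t, htle, htmin⟩ := (Set.isPWO_of_wellQuasiOrderedLE W).exists_le_minimal
      (show ((a : ℕ), (b : ℕ) - a, n - b) ∈ W from ⟨n, a, b, hab, hadj, rfl⟩)
    have hsum := hN (Set.mem_image_of_mem _ htmin)
    obtain ⟨m₀, i, j, hij, hadj₀, rfl⟩ := htmin.prop
    obtain ⟨hle1, hle2, hle3⟩ : (i : ℕ) ≤ a ∧ (j : ℕ) - i ≤ b - a ∧ m₀ - j ≤ n - b := htle
    have hij' : (i : ℕ) < j := hij
    have hab' : (a : ℕ) < b := hab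
    have hj := j.2
    have hb := b.2
    dsimp only at hsum
    -- A triple of sum m between the minimal one (sum m₀) and the given one (sum n): the surplus m -
    -- m₀ goes first to the left margin, then to the length, and the rest to the right margin.
    obtain ⟨a', b', h1, h2, h3, h4, h5, h6⟩ : ∃ a' b' : ℕ, (i : ℕ) ≤ a' ∧ a' + j ≤ b' + i ∧
        b' + m₀ ≤ m + j ∧ a' ≤ a ∧ a + b' ≤ b + a' ∧ b + m ≤ n + b' := by
      obtain ⟨a', ha'⟩ : ∃ a', a' = min (a : ℕ) (i + (m - m₀)) := ⟨_, rfl⟩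
      refine ⟨a', a' + min ((b : ℕ) - a) ((j : ℕ) - i + (m - m₀ - (a' - i))), ?_⟩
      omega
    have hb' : b' < m := by omega
    have ha' : a' < b' := by omega
    have hmem := hinv m₀ m (by omega) (by omega) (hG m₀ (by omega) ▸
      (X_mul_X_mem_incSpan_iff K (G m₀) (a := (⟨a', ha'.trans hb'⟩ : Fin m)) (b := ⟨b', hb'⟩)
        ha').2 ⟨i, j, hij, hadj₀, h1, h2, h3⟩)
    rw [hG m (by omega)] at hmem ⊢
    rw [X_mul_X_mem_edgeIdeal_iff] at hmem
    exact (X_mul_X_mem_incSpan_iff K (G m) hab).2 ⟨_, _, ha', hmem, h4, h5, h6⟩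
  intro a b hadj
  rcases lt_or_gt_of_ne hadj.ne with hlt | hlt
  · exact key a b hadj hlt
  · rw [mul_comm]
    exact key b a hadj.symm hlt

end Stability

/-! ### Combinatorial construction and conclusion -/

/-- The maximal independent set: the isolated vertices, and a window of `s` consecutive
vertices where `s` is the length of the shortest edge `{i, i + s}`. -/
theorem exists_maximal_independent {r n L M s i : ℕ} (G : SimpleGraph (Fin n))
    (E : ℕ → ℕ → Prop)
    (hGE : ∀ a b : Fin n, a < b → (G.Adj a b ↔ ∃ i j : ℕ, E i j ∧ i ≤ a ∧ (a : ℕ) + j ≤ b + i ∧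
        (b : ℕ) + r ≤ n + j))
    (hE : ∀ i j, E i j → L ≤ i ∧ i + s ≤ j ∧ j ≤ M)
    (hs : 0 < s) (hi : E i (i + s)) {j k : ℕ} (hL : E L j) (hM : E k M) (hMr : M < r)
    (hn : r + 2 * (M + 1 - L) ≤ n) :
    ∃ S : Finset (Fin n), S.card ≤ r - (M + 1 - L) + s ∧ (∀ u ∈ S, ∀ v ∈ S, ¬ G.Adj u v) ∧
      ∀ v, v ∉ S → ∃ u ∈ S, G.Adj v u := by
  have hi' := hE _ _ hi
  have hL' := hE _ _ hL
  have hM' := hE _ _ hM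
  let c := M + 1 - L + i
  refine ⟨Finset.univ.filter fun v : Fin n =>
    (v : ℕ) < L ∨ n + M < v + r ∨ (c ≤ v ∧ (v : ℕ) < c + s), ?_, ?_, ?_⟩
  · rw [← Finset.card_map Fin.valEmbedding]
    have hsub : (Finset.univ.filter fun v : Fin n =>
        (v : ℕ) < L ∨ n + M < v + r ∨ (c ≤ v ∧ (v : ℕ) < c + s)).map Fin.valEmbedding ⊆
        (Finset.range L ∪ Finset.Ico (n + M + 1 - r) n) ∪ Finset.Ico c (c + s) := by
      intro x hx
      simp only [Finset.mem_map, Finset.mem_filter, Finset.mem_univ, true_and,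
        Fin.valEmbedding_apply] at hx
      obtain ⟨v, hv, rfl⟩ := hx
      have := v.2
      simp only [Finset.mem_union, Finset.mem_range, Finset.mem_Ico]
      omega
    refine (Finset.card_le_card hsub).trans ((Finset.card_union_le _ _).trans
      ((Nat.add_le_add_right (Finset.card_union_le _ _) _).trans ?_))
    simp only [Finset.card_range, Nat.card_Ico]
    omega
  · have key : ∀ u v : Fin n, u < v →
        ((u : ℕ) < L ∨ n + M < u + r ∨ (c ≤ u ∧ (u : ℕ) < c + s)) →
        ((v : ℕ) < L ∨ n + M < v + r ∨ (c ≤ v ∧ (v : ℕ) < c + s)) → ¬ G.Adj u v := by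
      intro u v huv hu hv hadj
      obtain ⟨i', j', he, h1, h2, h3⟩ := (hGE u v huv).1 hadj
      have := hE _ _ he
      have : (u : ℕ) < v := huv
      omega
    intro u hu v hv hadj
    simp only [Finset.mem_filter, Finset.mem_univ, true_and] at hu hv
    rcases lt_or_gt_of_ne hadj.ne with hlt | hlt
    · exact key u v hlt hu hv hadj
    · exact key v u hlt hv hu hadj.symm
  · intro v hv
    simp only [Finset.mem_filter, Finset.mem_univ, true_and] at hv
    have hvn := v.2
    by_cases hvc : (v : ℕ) < c
    -- The last window vertex is the farthest from v. The shortest edge fits if v ≥ i; otherwise the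
    -- edge starting at L does, the distance then being at least M - L.
    · have hlt : v < (⟨c + s - 1, by omega⟩ : Fin n) := by
        rw [Fin.lt_def]; dsimp only; omega
      refine ⟨⟨c + s - 1, by omega⟩, ?_, (hGE _ _ hlt).2 ?_⟩
      · simp only [Finset.mem_filter, Finset.mem_univ, true_and]
        omega
      · dsimp only
        by_cases hvi : i ≤ v
        · exact ⟨_, _, hi, by omega, by omega, by omega⟩
        · exact ⟨_, _, hL, by omega, by omega, by omega⟩
    -- Symmetrically, v is joined to the first window vertex; when the right margin is too small for
    -- the shortest edge, the edge ending at M is used.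
    · have hlt : (⟨c, by omega⟩ : Fin n) < v := by
        rw [Fin.lt_def]; dsimp only; omega
      refine ⟨⟨c, by omega⟩, ?_, ((hGE _ _ hlt).2 ?_).symm⟩
      · simp only [Finset.mem_filter, Finset.mem_univ, true_and]
        omega
      · dsimp only
        by_cases hvi : v + r ≤ n + (i + s)
        · exact ⟨_, _, hi, by omega, by omega, by omega⟩
        · exact ⟨_, _, hM, by omega, by omega, by omega⟩

end InvChain

theorem theorem4p2 {K : Type*} [Field K]
    (I : ∀ n : ℕ, Ideal (MvPolynomial (Fin n) K))
    (G : ∀ n : ℕ, SimpleGraph (Fin n))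
    (hG : ∀ n : ℕ, 1 ≤ n → I n = InvChain.edgeIdeal K (G n))
    (hinv : InvChain.IsIncInvariant I)
    (hne : ∃ N : ℕ, ∀ n : ℕ, N ≤ n → I n ≠ ⊥)
    (r : ℕ) (hr : InvChain.stabilityIndex I = r)
    (n : ℕ) (hn : r + 2 * InvChain.rTilde (I r) ≤ n) :
    InvChain.depth (InvChain.gradedMaximalIdeal K n) (MvPolynomial (Fin n) K ⧸ I n) ≤
      ((r - InvChain.rTilde (I r) + InvChain.sparsityIndex (G r) : ℕ) : ℕ∞) := by
  -- Nonemptiness is essential: the infimum of an empty set would be the default 0.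
  obtain ⟨hr1, hstab⟩ : 1 ≤ r ∧ ∀ m n : ℕ, r ≤ m → m ≤ n → InvChain.incSpan n (I m) = I n :=
    hr ▸ Nat.sInf_mem (InvChain.stability_nonempty hG hinv)
  have hrn : r ≤ n := by omega
  rw [hG r hr1] at hn ⊢
  rw [hG n (hr1.trans hrn)]
  -- An edge of `G r`, oriented increasingly.
  let E : ℕ → ℕ → Prop := fun i j => ∃ u v : Fin r, u < v ∧ (G r).Adj u v ∧ i = u ∧ j = v
  have hGE : ∀ a b : Fin n, a < b → ((G n).Adj a b ↔ ∃ i j : ℕ, E i j ∧ i ≤ a ∧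
      (a : ℕ) + j ≤ b + i ∧ (b : ℕ) + r ≤ n + j) := by
    intro a b hab
    rw [← InvChain.X_mul_X_mem_edgeIdeal_iff K, ← hG n (hr1.trans hrn), ← hstab r n le_rfl hrn,
      hG r hr1, InvChain.X_mul_X_mem_incSpan_iff K _ hab]
    constructor
    · rintro ⟨i, j, hij, hadj, h⟩
      exact ⟨i, j, ⟨i, j, hij, hadj, rfl, rfl⟩, h⟩
    · rintro ⟨_, _, ⟨i, j, hij, hadj, rfl, rfl⟩, h⟩
      exact ⟨i, j, hij, hadj, h⟩
  have hE : ∀ u v : Fin r, (G r).Adj u v → E u v ∨ E v u := by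
    intro u v hadj
    rcases lt_or_gt_of_ne hadj.ne with hlt | hlt
    · exact Or.inl ⟨u, v, hlt, hadj, rfl, rfl⟩
    · exact Or.inr ⟨v, u, hlt, hadj.symm, rfl, rfl⟩
  have hEne : ∃ i j, E i j := by
    by_contra! hcon
    obtain ⟨N, hN⟩ := hne
    refine hN (max N r) (le_max_left _ _) ?_
    have hbot : I r = ⊥ := by
      rw [hG r hr1, eq_bot_iff, InvChain.edgeIdeal_le_iff]
      intro u v hadj
      exact ((hE u v hadj).elim (hcon _ _) (hcon _ _)).elim
    rw [← hstab r _ le_rfl (le_max_right N r), hbot, eq_bot_iff, InvChain.incSpan, Ideal.span_le]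
    rintro _ ⟨π, f, hf, rfl⟩
    rw [(Submodule.mem_bot _).1 hf, map_zero]
    exact Submodule.zero_mem _
  -- The extreme vertices on edges.
  have hgen := InvChain.mem_generatorSupport_edgeIdeal_iff K (G r)
  set T := InvChain.generatorSupport (InvChain.edgeIdeal K (G r)) with hT
  have hTE : ∀ i j, E i j → i + 1 ∈ T ∧ j + 1 ∈ T := by
    rintro _ _ ⟨u, v, -, hadj, rfl, rfl⟩
    exact ⟨(hgen _).2 ⟨u, v, hadj, rfl⟩, (hgen _).2 ⟨v, u, hadj.symm, rfl⟩⟩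
  have hTne : T.Nonempty := by
    obtain ⟨i, j, h⟩ := hEne
    exact ⟨_, (hTE i j h).1⟩
  have hTb : BddAbove T := by
    refine ⟨r, fun k hk => ?_⟩
    obtain ⟨u, -, -, rfl⟩ := (hgen k).1 hk
    exact u.2
  obtain ⟨uL, vL, hadjL, hL⟩ := (hgen _).1 (Nat.sInf_mem hTne)
  obtain ⟨uM, vM, hadjM, hM⟩ := (hgen _).1 (Nat.sSup_mem hTne hTb)
  have hbounds : ∀ i j, E i j → (uL : ℕ) ≤ i ∧ j ≤ (uM : ℕ) ∧ i < j ∧ uL ≤ j ∧ i ≤ uM := by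
    intro i j h
    have h1 := Nat.sInf_le (hTE i j h).1
    have h2 := le_csSup hTb (hTE i j h).2
    obtain ⟨u, v, huv, -, rfl, rfl⟩ := h
    have : (u : ℕ) < v := huv
    omega
  have hEL : E uL vL := (hE uL vL hadjL).resolve_right fun h => by
    have := hbounds _ _ h
    omega
  have hEM : E vM uM := (hE uM vM hadjM).resolve_left fun h => by
    have := hbounds _ _ h
    omega
  -- The supports count from 1 and the vertices from 0; the shift cancels in the difference.
  have hrT : InvChain.rTilde (InvChain.edgeIdeal K (G r)) = (uM : ℕ) + 1 - uL := by
    have := hbounds _ _ hEL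
    rw [InvChain.rTilde, InvChain.maxSupp, InvChain.minSupp, ← hT, hL, hM]
    omega
  -- A shortest edge.
  have hspne : {d : ℕ | ∃ i j : Fin r, i < j ∧ (G r).Adj i j ∧ d = (j : ℕ) - i}.Nonempty := by
    obtain ⟨_, _, u, v, huv, hadj, -, -⟩ := hEne
    exact ⟨_, u, v, huv, hadj, rfl⟩
  obtain ⟨i₀, j₀, hij₀, hadj₀, hs⟩ := Nat.sInf_mem hspne
  change InvChain.sparsityIndex (G r) = _ at hs
  have hij₀' : (i₀ : ℕ) < j₀ := hij₀
  have hsE : ∀ i j, E i j → i + InvChain.sparsityIndex (G r) ≤ j := by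
    rintro _ _ ⟨u, v, huv, hadj, rfl, rfl⟩
    have h1 : InvChain.sparsityIndex (G r) ≤ (v : ℕ) - u := Nat.sInf_le ⟨u, v, huv, hadj, rfl⟩
    have : (u : ℕ) < v := huv
    omega
  rw [hrT] at hn ⊢
  obtain ⟨S, hcard, hind, hmax⟩ := InvChain.exists_maximal_independent
    (s := InvChain.sparsityIndex (G r)) (i := i₀) (G n) E hGE
    (fun i j h => ⟨(hbounds i j h).1, hsE i j h, (hbounds i j h).2.1⟩) (by omega)
    ⟨i₀, j₀, hij₀, hadj₀, rfl, by omega⟩ hEL hEM uM.2 hn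
  exact (InvChain.depth_edgeIdeal_le K (G n) S hind hmax).trans (by exact_mod_cast hcard)
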